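/- A *differential space* $(M,\mathscr F)$ is a topological space $M$ with a nonempty set $\mathscr F$ of functions $M\to\mathbb R$ such that (1) the topology of $M$ is the smallest one making all $f\in\mathscr F$ continuous; (2) $g\circ(f_1,\dots,f_m)\in\mathscr F$ for all $m\ge 0$, $g\in C^\infty(\mathbb R^m)$, $f_1,\dots,f_m\in\mathscr F$; (3) every function $M\to\mathbb R$ that agrees in a neighbourhood of each point with some element of $\mathscr F$ belongs to $\mathscr F$. A map $\varphi\colon(M,\mathscr F_M)\to(N,\mathscr F_N)$ is *smooth* if $f\circ\varphi\in\mathscr F_M$ for all $f\in\mathscr F_N$, and a *diffeomorphism* if it is invertible with smooth inverse. A subset $N\subseteq M$ carries the *subspace structure*, the smallest differential structure on $N$ containing the restrictions $f|_N$, $f\in\mathscr F$; a product $M_1\times M_2$ carries the *product structure*, the smallest one containing $\pi_1^*\mathscr F_1\cup\pi_2^*\mathscr F_2$. $\mathbb R^n$ carries $C^\infty(\mathbb R^n)$ and its subsets the subspace structure. A *derivation* of $\mathscr F$ is an $\mathbb R$-linear map $v\colon\mathscr F\to\mathscr F$ with $v(fg)=v(f)g+fv(g)$. An *integral curve* of $v$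 is a map $\gamma\colon J\to M$ from a connected set $J\subseteq\mathbb R$ with $0\in J$ such that either $J=\{0\}$, or $\gamma$ is smooth and $\frac{d}{dx}(f\circ\gamma)=v(f)\circ\gamma$ on $J$ for all $f\in\mathscr F$. It is *maximal* if for every integral curve $\tau\colon K\to M$ of $v$ with $\tau(0)=\gamma(0)$ we have $K\subseteq J$ and $\gamma|_K=\tau$. A *flow* of $v$ is a smooth map $\Phi\colon W\to M$, where $W\subseteq M\times\mathbb R$ is a subset containing $M\times\{0\}$ with the subspace structure of the product structure, such that for all $x\in M$: $\Phi(x,0)=x$; the set $I_x=\{t\in\mathbb R\mid (x,t)\in W\}$ is connected; and $\Phi(x,\cdot)\colon I_x\to M$ is a maximal integral curve of $v$. **Theorem.** Let $(M,\mathscr F)$ be a differential space diffeomorphic to a subset of some $\mathbb R^n$, and let $v\colon\mathscr F\to\mathscr F$ be a derivation. Then $v$ has a unique flow $\Phi\colon W\to M$ (both $W$ and $\Phi$ are unique). -/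

import Mathlib

open scoped ContDiff

noncomputable section

namespace Sikorski

/-- The initial topology of a set `A` of real-valued functions on `M`: the smallest topology
for which every function in `A` is continuous. -/
abbrev initialTopology {M : Type*} (A : Set (M → ℝ)) : TopologicalSpace M :=
  ⨅ f ∈ A, TopologicalSpace.induced f inferInstance

/-- A differential structure (in the sense of Sikorski) on `M`. The topology of the differential
space is by definition the initial topology of the set of functions, so it is not separate data:
a differential space is a type `M` together with a term of `DifferentialStructure M`. -/
structure DifferentialStructure (M : Type*) where
  /-- the "smooth functions by fiat" -/
  carrier : Set (M → ℝ)
  nonempty : carrier.Nonempty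
  /-- closure under composition with smooth functions of finitely many variables -/
  comp_mem : ∀ (m : ℕ) (g : (Fin m → ℝ) → ℝ), ContDiff ℝ ∞ g →
    ∀ f : Fin m → M → ℝ, (∀ i, f i ∈ carrier) → (fun x => g (fun i => f i x)) ∈ carrier
  /-- a function that agrees near every point with a function in the structure is in the
  structure -/
  local_mem : ∀ g : M → ℝ,
    (∀ p : M, ∃ U ∈ @nhds M (initialTopology carrier) p, ∃ a ∈ carrier, Set.EqOn g a U) →
    g ∈ carrier

theorem initialTopology_anti {M : Type*} {A B : Set (M → ℝ)} (h : A ⊆ B) :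
    initialTopology B ≤ initialTopology A :=
  biInf_mono h

namespace DifferentialStructure

variable {M N : Type*}

theorem const_mem (F : DifferentialStructure M) (c : ℝ) : (fun _ => c) ∈ F.carrier :=
  F.comp_mem 0 (fun _ => c) contDiff_const (fun i _ => i.elim0) (fun i => i.elim0)

/-- The `ℝ`-algebra of functions underlying a differential structure (pointwise operations). -/
def toSubalgebra (F : DifferentialStructure M) : Subalgebra ℝ (M → ℝ) where
  carrier := F.carrier
  mul_mem' := by
    intro a b ha hb
    have h := F.comp_mem 2 (fun y => y 0 * y 1) (by fun_prop) ![a, b]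
      (by intro i; fin_cases i <;> simpa)
    exact h
  add_mem' := by
    intro a b ha hb
    have h := F.comp_mem 2 (fun y => y 0 + y 1) (by fun_prop) ![a, b]
      (by intro i; fin_cases i <;> simpa)
    exact h
  algebraMap_mem' := fun c => F.const_mem c

/-- The differential structure generated by a set `A` of functions: the smallest differential
structure containing `A`, i.e. the intersection of all of them. -/
def generate (A : Set (M → ℝ)) : DifferentialStructure M where
  carrier := {f | ∀ G : DifferentialStructure M, A ⊆ G.carrier → f ∈ G.carrier}
  nonempty := ⟨fun _ => 0, fun G _ => G.const_mem 0⟩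
  comp_mem := fun m g hg f hf G hG => G.comp_mem m g hg f (fun i => hf i G hG)
  local_mem := by
    intro g hg G hG
    refine G.local_mem g fun p => ?_
    obtain ⟨U, hU, a, ha, hga⟩ := hg p
    refine ⟨U, ?_, a, ha G hG, hga⟩
    exact nhds_mono (initialTopology_anti fun f (hf : ∀ G : DifferentialStructure M,
      A ⊆ G.carrier → f ∈ G.carrier) => hf G hG) hU

/-- The subspace (induced) differential structure on a subset. -/
def subspace (F : DifferentialStructure M) (S : Set M) : DifferentialStructure S :=
  generate {g | ∃ f ∈ F.carrier, g = fun x : S => f x}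

/-- The product differential structure. -/
def prod (F : DifferentialStructure M) (G : DifferentialStructure N) :
    DifferentialStructure (M × N) :=
  generate ({h | ∃ f ∈ F.carrier, h = fun p => f p.1} ∪ {h | ∃ g ∈ G.carrier, h = fun p => g p.2})

/-- The standard differential structure on a finite-dimensional normed space: the smooth
functions. -/
def standard (E : Type*) [NormedAddCommGroup E] [NormedSpace ℝ E] [FiniteDimensional ℝ E] :
    DifferentialStructure E where
  carrier := {f | ContDiff ℝ ∞ f}
  nonempty := ⟨fun _ => 0, (contDiff_const : ContDiff ℝ ∞ (fun _ : E => (0 : ℝ)))⟩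
  comp_mem := fun _ _ hg _ hf => hg.comp (contDiff_pi.2 hf)
  local_mem := by
    intro g hg
    change ContDiff ℝ ∞ g
    refine contDiff_iff_contDiffAt.2 fun p => ?_
    obtain ⟨U, hU, a, ha, hga⟩ := hg p
    have hle : (inferInstance : TopologicalSpace E) ≤
        initialTopology {f : E → ℝ | ContDiff ℝ ∞ f} :=
      le_iInf₂ fun f (hf : ContDiff ℝ ∞ f) => continuous_iff_le_induced.1 hf.continuous
    have hU' : U ∈ nhds p := nhds_mono hle hU
    have ha' : ContDiff ℝ ∞ a := ha
    exact ha'.contDiffAt.congr_of_eventuallyEq (Filter.eventuallyEq_of_mem hU' hga)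

end DifferentialStructure

open DifferentialStructure

/-- Smooth maps of differential spaces. -/
def IsSmooth {M N : Type*} (F : DifferentialStructure M) (G : DifferentialStructure N)
    (φ : M → N) : Prop :=
  ∀ f ∈ G.carrier, f ∘ φ ∈ F.carrier

/-- Two differential spaces are diffeomorphic: there is an invertible smooth map with smooth
inverse. -/
def Diffeomorphic {M N : Type*} (F : DifferentialStructure M) (G : DifferentialStructure N) :
    Prop :=
  ∃ e : M ≃ N, IsSmooth F G e ∧ IsSmooth G F e.symm

/-- `g : J → ℝ`, a function on a subset `J` of the line, has derivative `c` at `t ∈ J`, as a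
limit of difference quotients inside `J`. The values off `J` of the extension of `g` by zero
are irrelevant. -/
def HasDerivOnAt (J : Set ℝ) (g : J → ℝ) (c : ℝ) (t : J) : Prop :=
  HasDerivWithinAt (Function.extend Subtype.val g 0) c J t

variable {M : Type*} {F : DifferentialStructure M}

/-- `γ : J → M` is an integral curve of the derivation `v`: its domain `J` is an interval
(a connected subset of the line) containing `0`, and either `J` is a single point, or `γ` is smooth
and `d/dx (f ∘ γ) = v(f) ∘ γ` for all `f` in the differential structure. -/
structure IsIntegralCurve (v : Derivation ℝ F.toSubalgebra F.toSubalgebra)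
    (J : Set ℝ) (γ : J → M) : Prop where
  zero_mem : (0 : ℝ) ∈ J
  connected : IsConnected J
  deriv_eq : J.Subsingleton ∨
    (IsSmooth ((standard ℝ).subspace J) F γ ∧
      ∀ (f : F.toSubalgebra) (t : J),
        HasDerivOnAt J (fun s => (f : M → ℝ) (γ s)) ((v f : M → ℝ) (γ t)) t)

/-- A maximal integral curve: every integral curve with the same starting point is a restriction
of it. -/
structure IsMaximalIntegralCurve (v : Derivation ℝ F.toSubalgebra F.toSubalgebra)
    (I : Set ℝ) (γ : I → M) : Prop extends IsIntegralCurve v I γ where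
  maximal : ∀ (K : Set ℝ) (τ : K → M) (hτ : IsIntegralCurve v K τ),
    τ ⟨0, hτ.zero_mem⟩ = γ ⟨0, zero_mem⟩ →
      ∃ h : K ⊆ I, ∀ t : K, γ ⟨t, h t.2⟩ = τ t

/-- `Φ : W → M` is a flow of the derivation `v`, where `W ⊆ M × ℝ` carries the subspace structure
of the product differential structure. -/
structure IsFlow (v : Derivation ℝ F.toSubalgebra F.toSubalgebra)
    (W : Set (M × ℝ)) (Φ : W → M) : Prop where
  smooth : IsSmooth ((F.prod (standard ℝ)).subspace W) F Φ
  zero_mem : ∀ x : M, (x, (0 : ℝ)) ∈ W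
  map_zero : ∀ x : M, Φ ⟨(x, 0), zero_mem x⟩ = x
  connected : ∀ x : M, IsConnected {t : ℝ | (x, t) ∈ W}
  maximal : ∀ x : M, IsMaximalIntegralCurve v {t : ℝ | (x, t) ∈ W} (fun t => Φ ⟨(x, t), t.2⟩)

end Sikorski

end

/-! Embed `M` in `ℝ^n` by a map `x`. Bump functions and Hadamard's lemma give a derivation the chain
rule `v(g ∘ x)(p) = dg(x p)(b p)`, where `b` collects the values of `v` on the coordinates; near
each point `b` is `X ∘ x` for a smooth vector field `X` on `ℝ^n`. So integral curves of `v` on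
nontrivial intervals are the curves in `M` whose images locally solve `y' = X(y)`.

A solution in `ℝ^n` may leave the image of `M` at once. Hence the domain `W` consists of the pairs
`(p, t)` for which a solution from `p` stays in `M` for all times between `0` and `t`; it need not
be open. ODE uniqueness makes the endpoint `Φ(p, t)` well defined, and maximality follows from the
choice of `W`.

The hard point is smoothness: near each point of `W`, `x ∘ Φ` must agree on `W` with a smooth map on
`ℝ^n × ℝ`. For short times the local flow of `X` serves; its smoothness comes from the implicit
function theorem for `γ = y + t ∫ X ∘ γ` in the Banach space `C([0,1], ℝ^n)`
(`exists_smooth_localFlow`). For long times these local maps are composed: flow for time `k t`, then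
for `(1 - k) t`. Both steps stay in the domain because `W` is star-shaped in time, so openness is
never needed (`exists_contDiff_flowMap_eq`). Uniqueness of the flow is maximality applied in both
directions. -/

open Set Filter Topology

/-! ### Differentiating postcomposition on spaces of continuous maps -/

section Postcomposition

universe u
variable {K : Type*} [TopologicalSpace K] [CompactSpace K]
  {E F : Type u} [NormedAddCommGroup E] [NormedSpace ℝ E] [NormedAddCommGroup F] [NormedSpace ℝ F]

/-- Pointwise application of a continuous family of operators to a continuous curve. -/
noncomputable def ContinuousMap.pointwiseApply (K : Type*) [TopologicalSpace K] [CompactSpace K]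
    (E F : Type u) [NormedAddCommGroup E] [NormedSpace ℝ E] [NormedAddCommGroup F]
    [NormedSpace ℝ F] : C(K, E →L[ℝ] F) →L[ℝ] C(K, E) →L[ℝ] C(K, F) :=
  LinearMap.mkContinuous₂
    (LinearMap.mk₂ ℝ (fun (A : C(K, E →L[ℝ] F)) (δ : C(K, E)) =>
        (⟨fun k => A k (δ k), by fun_prop⟩ : C(K, F)))
      (fun _ _ _ => by ext; simp) (fun _ _ _ => by ext; simp)
      (fun _ _ _ => by ext; simp) (fun _ _ _ => by ext; simp)) 1
    (fun A δ => by
      rw [ContinuousMap.norm_le _ (by positivity)]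
      intro k
      refine ((A k).le_opNorm _).trans ?_
      rw [one_mul]
      exact mul_le_mul (A.norm_coe_le_norm k) (δ.norm_coe_le_norm k) (norm_nonneg (δ k))
        (norm_nonneg A))

@[simp]
theorem ContinuousMap.pointwiseApply_apply (A : C(K, E →L[ℝ] F)) (δ : C(K, E)) (k : K) :
    ContinuousMap.pointwiseApply K E F A δ k = A k (δ k) := rfl

/-- The mean value inequality on the segment from `γ k` to `γ' k` bounds the remainder by the
variation of `f'` there. This is small uniformly in `k`, since postcomposition with `f'` is
continuous in the sup norm. -/
theorem ContinuousMap.hasFDerivAt_comp_left (f : C(E, F)) (f' : C(E, E →L[ℝ] F))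
    (hf : ∀ y, HasFDerivAt f (f' y) y) (γ : C(K, E)) :
    HasFDerivAt (fun γ : C(K, E) => f.comp γ)
      (ContinuousMap.pointwiseApply K E F (f'.comp γ)) γ := by
  rw [hasFDerivAt_iff_isLittleO, Asymptotics.isLittleO_iff]
  intro ε hε
  have hc := (ContinuousMap.continuous_postcomp (X := K) f').continuousAt (x := γ)
  obtain ⟨r, hr, h⟩ := (Metric.continuousAt_iff
    (f := fun γ : C(K, E) => f'.comp γ) (a := γ)).1 hc ε hε
  filter_upwards [Metric.ball_mem_nhds γ hr] with γ' hγ'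
  rw [ContinuousMap.norm_le _ (by positivity)]
  intro k
  have hk : ‖γ' k - γ k‖ ≤ ‖γ' - γ‖ := (γ' - γ).norm_coe_le_norm k
  refine le_trans ?_ (mul_le_mul_of_nonneg_left hk hε.le)
  have := (convex_segment (γ k) (γ' k)).norm_image_sub_le_of_norm_hasFDerivWithin_le'
    (f := f) (f' := f') (φ := f' (γ k)) (C := ε)
    (fun y _ => (hf y).hasFDerivWithinAt) ?_ (left_mem_segment ℝ _ _) (right_mem_segment ℝ _ _)
  · simpa using this
  intro y hy
  obtain ⟨θ, hθ, rfl⟩ := (segment_eq_image' ℝ (γ k) (γ' k)) ▸ hy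
  have hd : dist (γ + θ • (γ' - γ)) γ < r := by
    rw [dist_eq_norm, add_sub_cancel_left, norm_smul, Real.norm_of_nonneg hθ.1]
    have : ‖γ' - γ‖ < r := by simpa [dist_eq_norm] using hγ'
    nlinarith [hθ.2, norm_nonneg (γ' - γ)]
  have h2 := (ContinuousMap.dist_apply_le_dist k).trans (h hd).le
  rw [dist_eq_norm] at h2
  exact h2

/-- The derivative is postcomposition with `f'` followed by a bounded linear map, so induction works
once the target `F` is allowed to vary. -/
theorem ContinuousMap.contDiff_nat_comp_left (m : ℕ) : ∀ {F : Type u} [NormedAddCommGroup F]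
    [NormedSpace ℝ F] (f : C(E, F)), ContDiff ℝ m f →
      ContDiff ℝ m (fun γ : C(K, E) => f.comp γ) := by
  induction m with
  | zero => exact fun f _ => contDiff_zero.2 (ContinuousMap.continuous_postcomp f)
  | succ m ih =>
    intro F _ _ f hf
    rw [Nat.cast_add, Nat.cast_one] at hf ⊢
    have hf1 := contDiff_succ_iff_fderiv.1 hf
    let f' : C(E, E →L[ℝ] F) := ⟨fderiv ℝ f, hf1.2.2.continuous⟩
    have hd := ContinuousMap.hasFDerivAt_comp_left (K := K) f f'
      (fun y => (hf1.1 y).hasFDerivAt)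
    refine contDiff_succ_iff_fderiv.2 ⟨fun γ => (hd γ).differentiableAt, by simp, ?_⟩
    rw [show fderiv ℝ (fun γ : C(K, E) => f.comp γ) = fun γ =>
      ContinuousMap.pointwiseApply K E F (f'.comp γ) from funext fun γ => (hd γ).fderiv]
    exact (ContinuousMap.pointwiseApply K E F).contDiff.comp (ih f' hf1.2.2)

/-- Postcomposition with a smooth map is a smooth map between spaces of continuous functions. -/
theorem ContinuousMap.contDiff_comp_left (f : C(E, F)) (hf : ContDiff ℝ ∞ f) :
    ContDiff ℝ ∞ (fun γ : C(K, E) => f.comp γ) :=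
  contDiff_infty.2 fun m =>
    ContinuousMap.contDiff_nat_comp_left m f (contDiff_infty.1 hf m)

end Postcomposition

/-! ### Globalizing smooth germs by cutoff -/

section Extension

variable {E F : Type*} [NormedAddCommGroup E] [NormedSpace ℝ E] [HasContDiffBump E]
  [NormedAddCommGroup F] [NormedSpace ℝ F]

/-- A function that is smooth near a point has the germ of a globally smooth function there. -/
theorem exists_contDiff_eventuallyEq {f : E → F} {y : E}
    (hf : ∀ᶠ z in 𝓝 y, ContDiffAt ℝ ∞ f z) :
    ∃ g : E → F, ContDiff ℝ ∞ g ∧ g =ᶠ[𝓝 y] f := by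
  obtain ⟨r, hr, h⟩ := Metric.eventually_nhds_iff_ball.1 hf
  let χ : ContDiffBump y := ⟨r / 4, r / 2, by positivity, by linarith⟩
  refine ⟨fun z => χ z • f z, contDiff_iff_contDiffAt.2 fun z => ?_, ?_⟩
  · by_cases hz : z ∈ Metric.ball y r
    · exact χ.contDiffAt.smul (h z hz)
    · have : ∀ᶠ z' in 𝓝 z, χ z' • f z' = 0 := by
        have hz' : z ∈ (Metric.closedBall y (r / 2))ᶜ := by
          simp only [Metric.mem_ball, mem_compl_iff, Metric.mem_closedBall] at hz ⊢
          linarith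
        filter_upwards [Metric.isClosed_closedBall.isOpen_compl.mem_nhds hz'] with z' h'
        simp only [mem_compl_iff, Metric.mem_closedBall, not_le] at h'
        rw [χ.zero_of_le_dist h'.le, zero_smul]
      exact contDiffAt_const.congr_of_eventuallyEq this
  · filter_upwards [χ.eventuallyEq_one] with z hz
    simp [hz]

end Extension

/-! ### Primitives and Hadamard's lemma -/

section Hadamard

universe u
variable {E F : Type u} [NormedAddCommGroup E] [NormedSpace ℝ E] [NormedAddCommGroup F]
  [NormedSpace ℝ F]

/-- Integration of continuous functions on the unit interval from `0` to `θ`, as a function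
of `θ`. -/
noncomputable def ContinuousMap.primitive (F : Type*) [NormedAddCommGroup F] [NormedSpace ℝ F] :
    C(unitInterval, F) →L[ℝ] C(unitInterval, F) :=
  LinearMap.mkContinuous
    { toFun := fun γ => ⟨fun θ => ∫ s in (0 : ℝ)..θ, IccExtend zero_le_one γ s, by
        have := intervalIntegral.continuous_primitive (μ := MeasureTheory.volume)
          (f := IccExtend zero_le_one γ)
          (fun a b => (γ.continuous.Icc_extend' (h := zero_le_one)).intervalIntegrable a b) 0
        exact this.comp continuous_subtype_val⟩
      map_add' := fun γ δ => by
        ext θ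
        exact intervalIntegral.integral_add
          ((γ.continuous.Icc_extend' (h := zero_le_one)).intervalIntegrable _ _)
          ((δ.continuous.Icc_extend' (h := zero_le_one)).intervalIntegrable _ _)
      map_smul' := fun c γ => by
        ext θ
        exact intervalIntegral.integral_smul c _ } 1
    (fun γ => by
      rw [ContinuousMap.norm_le _ (by positivity)]
      intro θ
      refine (intervalIntegral.norm_integral_le_of_norm_le_const (C := ‖γ‖)
        fun s _ => γ.norm_coe_le_norm _).trans ?_
      rw [sub_zero, abs_of_nonneg θ.2.1, one_mul]
      exact mul_le_of_le_one_right (norm_nonneg _) θ.2.2)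

theorem ContinuousMap.primitive_apply (γ : C(unitInterval, F)) (θ : unitInterval) :
    ContinuousMap.primitive F γ θ = ∫ s in (0 : ℝ)..θ, IccExtend zero_le_one γ s := rfl

/-- **Hadamard's lemma**. -/
theorem exists_contDiff_sub_eq_apply [CompleteSpace F] {g : E → F} (hg : ContDiff ℝ ∞ g) (a : E) :
    ∃ h : E → E →L[ℝ] F, ContDiff ℝ ∞ h ∧ h a = fderiv ℝ g a ∧
      ∀ y, g y = g a + h y (y - a) := by
  have hg' : ContDiff ℝ ∞ (fderiv ℝ g) := (contDiff_infty_iff_fderiv.1 hg).2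
  let g' : C(E, E →L[ℝ] F) := ⟨fderiv ℝ g, hg'.continuous⟩
  let T : E →L[ℝ] C(unitInterval, E) := LinearMap.mkContinuous
    { toFun := fun y => ⟨fun θ => (θ : ℝ) • y, by fun_prop⟩
      map_add' := fun y z => by ext θ; simp
      map_smul' := fun c y => by ext θ; simp [smul_comm c] } 1
    (fun y => by
      rw [ContinuousMap.norm_le _ (by positivity)]
      intro θ
      simp only [LinearMap.coe_mk, AddHom.coe_mk, ContinuousMap.coe_mk, norm_smul,
        Real.norm_eq_abs, abs_of_nonneg θ.2.1]
      gcongr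
      exact θ.2.2)
  let ev : C(unitInterval, E →L[ℝ] F) →L[ℝ] E →L[ℝ] F :=
    ContinuousMap.evalCLM ℝ (1 : unitInterval)
  -- This is `∫₀¹ Dg(a + s(y - a)) ds`, written as a composite of smooth maps through `C([0,1], E)`
  -- so that no differentiation under the integral is needed.
  refine ⟨fun y => ev (ContinuousMap.primitive _ (g'.comp (ContinuousMap.const _ a + T (y - a)))),
    ?_, ?_, ?_⟩
  · exact ev.contDiff.comp ((ContinuousMap.primitive (E →L[ℝ] F)).contDiff.comp
      ((ContinuousMap.contDiff_comp_left g' hg').comp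
        (contDiff_const.add (T.contDiff.comp (contDiff_id.sub contDiff_const)))))
  · have : (g'.comp (ContinuousMap.const _ a + T (a - a))) = ContinuousMap.const _ (g' a) := by
      ext θ; simp
    beta_reduce
    rw [this]
    simp [ev, ContinuousMap.primitive_apply, g', IccExtend]
  · intro y
    have hder : ∀ s : ℝ, HasDerivAt (fun s : ℝ => g (a + s • (y - a)))
        (fderiv ℝ g (a + s • (y - a)) (y - a)) s := fun s =>
      ((hg.differentiable (by simp)) _).hasFDerivAt.comp_hasDerivAt s
        (by simpa using ((hasDerivAt_id s).smul_const (y - a)).const_add a)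
    have hcont : Continuous fun s : ℝ => fderiv ℝ g (a + s • (y - a)) :=
      hg'.continuous.comp (by fun_prop)
    have hint := intervalIntegral.integral_eq_sub_of_hasDerivAt (a := 0) (b := 1)
      (fun s _ => hder s) ((hcont.clm_apply continuous_const).intervalIntegrable _ _)
    have hval : ev (ContinuousMap.primitive _
        (g'.comp (ContinuousMap.const _ a + T (y - a)))) =
        ∫ s in (0 : ℝ)..1, fderiv ℝ g (a + s • (y - a)) := by
      change ∫ s in (0 : ℝ)..1, _ = _
      refine intervalIntegral.integral_congr fun s hs => ?_
      rw [uIcc_of_le zero_le_one] at hs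
      rw [ContinuousMap.coe_IccExtend, IccExtend_of_mem _ _ hs]
      rfl
    beta_reduce
    rw [hval, ContinuousLinearMap.intervalIntegral_apply (hcont.intervalIntegrable _ _), hint]
    simp

end Hadamard

/-! ### Implicit functions smooth on a neighbourhood -/

section ImplicitFunction

variable {E₁ E₂ F : Type*} [NormedAddCommGroup E₁] [NormedSpace ℝ E₁] [CompleteSpace E₁]
  [NormedAddCommGroup E₂] [NormedSpace ℝ E₂] [CompleteSpace E₂]
  [NormedAddCommGroup F] [NormedSpace ℝ F] [CompleteSpace F]

/-- The implicit function theorem for smooth equations, with smoothness near the base point. -/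
theorem ContDiff.exists_implicitFunction {f : E₁ × E₂ → F} (hf : ContDiff ℝ ∞ f) (u : E₁ × E₂)
    (hu : (fderiv ℝ f u ∘L .inr ℝ E₁ E₂).IsInvertible) :
    ∃ ψ : E₁ → E₂, ψ u.1 = u.2 ∧ ∀ᶠ z in 𝓝 u.1, ContDiffAt ℝ ∞ ψ z ∧ f (z, ψ z) = f u := by
  have h0 : (∞ : WithTop ℕ∞) ≠ 0 := by simp
  set ψ := hf.contDiffAt.implicitFunction (u := u) h0 hu
  have hψ0 : ψ u.1 = u.2 := hf.contDiffAt.implicitFunction_apply_self h0 hu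
  have hψ1 : ∀ᶠ z in 𝓝 u.1, ContDiffAt ℝ 1 ψ z :=
    ((hf.contDiffAt.contDiffAt_implicitFunction h0 hu).of_le
      (by exact_mod_cast le_top)).eventually (by simp)
  have hψeq : ∀ᶠ z in 𝓝 u.1, f (z, ψ z) = f u :=
    hf.contDiffAt.eventually_apply_implicitFunction h0 hu
  -- Being `C^∞` at one point gives `C^m` neighbourhoods that may shrink with `m`. So the theorem is
  -- reapplied at each nearby solution, where invertibility persists, and local uniqueness
  -- identifies the two implicit functions.
  have hinv : ∀ᶠ z in 𝓝 u.1, (fderiv ℝ f (z, ψ z) ∘L .inr ℝ E₁ E₂).IsInvertible := by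
    obtain ⟨e, he⟩ := hu
    have hcont : ContinuousAt (fun z => fderiv ℝ f (z, ψ z) ∘L .inr ℝ E₁ E₂) u.1 := by
      have h1 : ContinuousAt (fun z => (z, ψ z)) u.1 :=
        continuousAt_id.prodMk hψ1.self_of_nhds.continuousAt
      exact ((hf.continuous_fderiv h0).continuousAt.comp h1).clm_comp continuousAt_const
    have := hcont.preimage_mem_nhds (t := range ((↑) : (E₂ ≃L[ℝ] F) → E₂ →L[ℝ] F))
      (by rw [hψ0, ← he]; exact e.nhds)
    filter_upwards [this] with z hz using hz
  refine ⟨ψ, hψ0, ?_⟩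
  filter_upwards [hψ1, hψeq, hψeq.eventually_nhds, hinv] with z h1 h2 h3 h4
  refine ⟨?_, h2⟩
  have hc : ContinuousAt (fun z => (z, ψ z)) z := continuousAt_id.prodMk h1.continuousAt
  have h5 := hc.eventually
    (hf.contDiffAt.eventually_apply_eq_iff_implicitFunction (u := (z, ψ z)) h0 h4)
  have h6 := hf.contDiffAt.contDiffAt_implicitFunction (u := (z, ψ z)) h0 h4
  refine h6.congr_of_eventuallyEq ?_
  filter_upwards [h3, h5] with z' h7 h8
  exact (h8.1 (h7.trans h2.symm)).symm

end ImplicitFunction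

/-! ### Smooth dependence and uniqueness for ordinary differential equations -/

section Flow

variable {E : Type*} [NormedAddCommGroup E] [NormedSpace ℝ E]

/-- Smooth dependence of short integral curves, parametrized by the unit interval, on the initial
point and on the length of the time interval. -/
theorem exists_smooth_localFlow [CompleteSpace E] {X : E → E} (hX : ContDiff ℝ ∞ X) (y₀ : E) :
    ∃ Γ : E × ℝ → C(unitInterval, E), Γ (y₀, 0) = ContinuousMap.const _ y₀ ∧
      ∀ᶠ z in 𝓝 (y₀, (0 : ℝ)), ContDiffAt ℝ ∞ Γ z ∧
        Γ z = ContinuousMap.const _ z.1 +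
          z.2 • ContinuousMap.primitive E ((⟨X, hX.continuous⟩ : C(E, E)).comp (Γ z)) := by
  let X' : C(E, E) := ⟨X, hX.continuous⟩
  let c : E →L[ℝ] C(unitInterval, E) := ContinuousLinearMap.const ℝ unitInterval
  let P : C(unitInterval, E) → C(unitInterval, E) := fun γ => ContinuousMap.primitive E (X'.comp γ)
  have hP : ContDiff ℝ ∞ P :=
    (ContinuousMap.primitive E).contDiff.comp (ContinuousMap.contDiff_comp_left X' hX)
  -- Zeros of `f` are curves with `γ(θ) = y + t ∫₀^θ X ∘ γ`. At `t = 0` the integral term drops out,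
  -- so the partial derivative in `γ` is the identity.
  let f : (E × ℝ) × C(unitInterval, E) → C(unitInterval, E) :=
    fun u => u.2 - u.1.2 • P u.2 - c u.1.1
  have hf : ContDiff ℝ ∞ f := by
    have h1 : ContDiff ℝ ∞ fun u : (E × ℝ) × C(unitInterval, E) => P u.2 := hP.comp contDiff_snd
    have h2 : ContDiff ℝ ∞ fun u : (E × ℝ) × C(unitInterval, E) => c u.1.1 :=
      c.contDiff.comp (by fun_prop)
    exact (contDiff_snd.sub ((contDiff_snd.comp contDiff_fst).smul h1)).sub h2
  let u : (E × ℝ) × C(unitInterval, E) := ((y₀, 0), c y₀)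
  have hfu : f u = 0 := by simp [f, u]
  have hinv : (fderiv ℝ f u ∘L .inr ℝ (E × ℝ) C(unitInterval, E)) =
      ContinuousLinearMap.id ℝ _ := by
    have h1 : HasFDerivAt (fun γ => f ((y₀, 0), γ))
        (fderiv ℝ f u ∘L .inr ℝ (E × ℝ) C(unitInterval, E)) (c y₀) :=
      ((hf.differentiable (by simp)) u).hasFDerivAt.comp (c y₀) (hasFDerivAt_prodMk_right _ _)
    have h2 : HasFDerivAt (fun γ => f ((y₀, 0), γ)) (ContinuousLinearMap.id ℝ _) (c y₀) := by
      simpa [f] using (hasFDerivAt_id (𝕜 := ℝ) (c y₀)).sub_const (c y₀)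
    exact h1.unique h2
  obtain ⟨Γ, h0, h⟩ := hf.exists_implicitFunction u
    (hinv ▸ ⟨ContinuousLinearEquiv.refl ℝ _, rfl⟩)
  refine ⟨Γ, h0, ?_⟩
  filter_upwards [h] with z hz
  refine ⟨hz.1, ?_⟩
  have := hz.2.trans hfu
  rw [sub_eq_zero, sub_eq_iff_eq_add] at this
  exact this

theorem hasDerivWithinAt_of_eq_const_add_primitive [CompleteSpace E] {γ δ : C(unitInterval, E)}
    {y : E} {t : ℝ} (h : γ = ContinuousMap.const _ y + t • ContinuousMap.primitive E δ)
    {s : ℝ} (hs : s ∈ Icc (0 : ℝ) 1) :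
    HasDerivWithinAt (IccExtend zero_le_one γ) (t • δ ⟨s, hs⟩) (Icc 0 1) s := by
  have hc : Continuous (IccExtend (zero_le_one' ℝ) δ) := δ.continuous.Icc_extend'
  have h1 : HasDerivAt (fun s => ∫ r in (0 : ℝ)..s, IccExtend (zero_le_one' ℝ) δ r)
      (IccExtend (zero_le_one' ℝ) δ s) s :=
    intervalIntegral.integral_hasDerivAt_right (hc.intervalIntegrable _ _)
      (hc.stronglyMeasurableAtFilter _ _) hc.continuousAt
  rw [IccExtend_of_mem _ _ hs] at h1
  refine (((h1.const_smul t).const_add y).hasDerivWithinAt (s := Icc 0 1)).congr_of_mem ?_ hs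
  intro r hr
  rw [IccExtend_of_mem _ _ hr, h]
  rfl

/-- Uniqueness of solutions of locally autonomous differential equations. -/
theorem eqOn_Icc_of_local_autonomous {u w : ℝ → E} (hu : ContinuousOn u (Icc 0 1))
    (hw : ContinuousOn w (Icc 0 1)) (h0 : u 0 = w 0)
    (h : ∀ s ∈ Icc (0 : ℝ) 1, u s = w s → ∃ X : E → E, ContDiff ℝ ∞ X ∧
      ∀ᶠ r in 𝓝[Icc 0 1] s, HasDerivWithinAt u (X (u r)) (Icc 0 1) r ∧
        HasDerivWithinAt w (X (w r)) (Icc 0 1) r) :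
    EqOn u w (Icc 0 1) := by
  -- Continuous induction: the agreement set is closed, contains `0`, and by Lipschitz uniqueness
  -- extends to the right of each of its points below `1`.
  have hcl : IsClosed ({s | u s = w s} ∩ Icc (0 : ℝ) 1) := by
    have := (hu.prodMk hw).preimage_isClosed_of_isClosed isClosed_Icc
      (isClosed_diagonal (X := E))
    rw [inter_comm]
    exact this
  refine fun s hs => hcl.Icc_subset_of_forall_mem_nhdsWithin h0 ?_ hs
  rintro s ⟨heq, hs⟩
  have hs' : s ∈ Icc (0 : ℝ) 1 := Ico_subset_Icc_self hs
  obtain ⟨X, hX, hd⟩ := h s hs' heq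
  obtain ⟨K, N, hN, hK⟩ := (hX.contDiffAt (x := u s)).of_le
    (by exact_mod_cast le_top : (1 : WithTop ℕ∞) ≤ ∞) |>.exists_lipschitzOnWith
  have e1 : ∀ᶠ r in 𝓝[Icc 0 1] s, u r ∈ N := hu s hs' hN
  have e2 : ∀ᶠ r in 𝓝[Icc 0 1] s, w r ∈ N := hw s hs' (by rwa [← show u s = w s from heq])
  have e3 := hd.and (e1.and e2)
  have hle : 𝓝[≥] s ≤ 𝓝[Icc 0 1] s := by
    rw [← nhdsWithin_Icc_eq_nhdsGE hs.2]
    exact nhdsWithin_mono _ (Icc_subset_Icc_left hs.1)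
  obtain ⟨b, hb, hbs⟩ := (mem_nhdsGE_iff_exists_Icc_subset).1 (hle e3)
  have hb' : Icc s (min b 1) ⊆ Icc s b := Icc_subset_Icc_right (min_le_left _ _)
  have hb1 : Icc s (min b 1) ⊆ Icc 0 1 := Icc_subset_Icc hs.1 (min_le_right _ _)
  have hder : ∀ {g : ℝ → E} {g' : E} {r : ℝ}, r ∈ Ico s (min b 1) →
      HasDerivWithinAt g g' (Icc 0 1) r → HasDerivWithinAt g g' (Ici r) r := by
    intro g g' r hr hg
    refine hg.mono_of_mem_nhdsWithin ?_
    have : Icc r 1 ∈ 𝓝[≥] r := Icc_mem_nhdsGE (hr.2.trans_le (min_le_right _ _))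
    exact mem_of_superset this (Icc_subset_Icc_left (hs.1.trans hr.1))
  have key := ODE_solution_unique_of_mem_Icc_right (v := fun _ => X) (s := fun _ => N) (K := K)
    (a := s) (b := min b 1) (f := u) (g := w) (fun _ _ => hK) (hu.mono hb1)
    (fun r hr => hder hr (hbs (hb' (Ico_subset_Icc_self hr))).1.1)
    (fun r hr => (hbs (hb' (Ico_subset_Icc_self hr))).2.1) (hw.mono hb1)
    (fun r hr => hder hr (hbs (hb' (Ico_subset_Icc_self hr))).1.2)
    (fun r hr => (hbs (hb' (Ico_subset_Icc_self hr))).2.2) heq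
  exact mem_of_superset (Icc_mem_nhdsGT (lt_min hb hs.2)) key

end Flow

namespace Sikorski

open DifferentialStructure

/-! ### Differential structures in coordinates -/

section Membership

variable {N E : Type*} [NormedAddCommGroup E] [NormedSpace ℝ E] [FiniteDimensional ℝ E]

theorem DifferentialStructure.subset_generate (A : Set (N → ℝ)) : A ⊆ (generate A).carrier :=
  fun _ hf _ hG => hG hf

theorem DifferentialStructure.generate_subset {A : Set (N → ℝ)} {G : DifferentialStructure N}
    (h : A ⊆ G.carrier) : (generate A).carrier ⊆ G.carrier :=
  fun _ hf => hf G h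

theorem DifferentialStructure.restrict_mem_subspace {F : DifferentialStructure N} {f : N → ℝ}
    (hf : f ∈ F.carrier) (S : Set N) : (fun x : S => f x) ∈ (F.subspace S).carrier :=
  subset_generate _ ⟨f, hf, rfl⟩

/-- If the linear functionals of a map into a finite-dimensional space belong to the structure,
so do all smooth functions of that map. -/
theorem DifferentialStructure.comp_mem_of_clm_comp_mem (F : DifferentialStructure N) {c : N → E}
    (hc : ∀ l : E →L[ℝ] ℝ, (fun q => l (c q)) ∈ F.carrier) {g : E → ℝ} (hg : ContDiff ℝ ∞ g) :
    (fun q => g (c q)) ∈ F.carrier := by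
  let e : E ≃L[ℝ] (Fin (Module.finrank ℝ E) → ℝ) :=
    ContinuousLinearEquiv.ofFinrankEq (by simp)
  have := F.comp_mem _ (g ∘ e.symm) (hg.comp e.symm.contDiff)
    (fun i q => e (c q) i)
    (fun i => hc ((ContinuousLinearMap.proj (R := ℝ) (φ := fun _ => ℝ) i).comp
      (e : E →L[ℝ] (Fin (Module.finrank ℝ E) → ℝ))))
  simpa using this

/-- A function that is locally a smooth function of `c` belongs to the structure. -/
theorem DifferentialStructure.mem_of_local_comp (F : DifferentialStructure N) {c : N → E}
    (hc : ∀ l : E →L[ℝ] ℝ, (fun q => l (c q)) ∈ F.carrier) {f : N → ℝ}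
    (hf : ∀ p, ∃ g : E → ℝ, ContDiff ℝ ∞ g ∧ ∀ᶠ q in comap c (𝓝 (c p)), f q = g (c q)) :
    f ∈ F.carrier := by
  refine F.local_mem f fun p => ?_
  obtain ⟨g, hg, h⟩ := hf p
  refine ⟨{q | f q = g (c q)}, ?_, _, F.comp_mem_of_clm_comp_mem hc hg, fun q hq => hq⟩
  rw [eventually_comap] at h
  obtain ⟨r, hr, h⟩ := Metric.eventually_nhds_iff_ball.1 h
  -- The positivity set of `χ ∘ c` is open in the initial topology because `χ ∘ c` belongs to the
  -- structure.
  let χ : ContDiffBump (c p) := ⟨r / 2, r, by positivity, by linarith⟩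
  have hχ : (fun q => χ (c q)) ∈ F.carrier := F.comp_mem_of_clm_comp_mem hc χ.contDiff
  let _ : TopologicalSpace N := initialTopology F.carrier
  have hcont : Continuous fun q => χ (c q) :=
    continuous_iff_le_induced.2 (iInf₂_le (fun q => χ (c q)) hχ)
  have hp : 0 < χ (c p) := χ.pos_of_mem_ball (Metric.mem_ball_self hr)
  filter_upwards [hcont.continuousAt.eventually (lt_mem_nhds hp)] with q hq
  refine h (c q) ?_ q rfl
  have : c q ∈ Function.support χ := hq.ne'
  rwa [χ.support_eq] at this

/-- The functions on a subset of a finite-dimensional space that extend locally to smooth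
functions. -/
def locallyExtendable (S : Set E) : DifferentialStructure S where
  carrier := {f | ∀ p, ∃ g : E → ℝ, ContDiff ℝ ∞ g ∧ ∀ᶠ q in 𝓝 p, f q = g q}
  nonempty := ⟨fun _ => 0, fun _ => ⟨fun _ => 0, contDiff_const, by simp⟩⟩
  comp_mem := by
    intro m k hk f hf p
    choose g hg h using fun i => hf i p
    refine ⟨fun y => k fun i => g i y, hk.comp (contDiff_pi.2 hg), ?_⟩
    filter_upwards [eventually_all.2 h] with q hq
    simp [hq]
  local_mem := by
    intro f hf p
    obtain ⟨U, hU, a, ha, hfa⟩ := hf p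
    obtain ⟨g, hg, h⟩ := ha p
    refine ⟨g, hg, ?_⟩
    have hle : (inferInstance : TopologicalSpace S) ≤ initialTopology
        {f : S → ℝ | ∀ p, ∃ g : E → ℝ, ContDiff ℝ ∞ g ∧ ∀ᶠ q in 𝓝 p, f q = g q} := by
      refine le_iInf₂ fun f hf => continuous_iff_le_induced.1 ?_
      refine continuous_iff_continuousAt.2 fun p => ?_
      obtain ⟨g, hg, h⟩ := hf p
      exact (hg.continuous.comp continuous_subtype_val).continuousAt.congr
        (h.mono fun q hq => hq.symm)
    filter_upwards [h, nhds_mono hle hU] with q h1 h2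
    rw [hfa h2, h1]

/-- Locally extendable functions already form a differential structure containing the restrictions,
so the smallest such structure lies inside it. -/
theorem subspace_standard_subset (S : Set E) :
    ((standard E).subspace S).carrier ⊆ (locallyExtendable S).carrier := by
  refine generate_subset ?_
  rintro _ ⟨f, hf, rfl⟩ p
  exact ⟨f, hf, by simp⟩

end Membership

variable {M E : Type*} [NormedAddCommGroup E] [NormedSpace ℝ E]
  {F : DifferentialStructure M}

/-- An injective map `x` into a normed space such that the functions of the structure are exactly
those that are locally smooth functions of `x`. -/
structure IsSmoothEmbedding (F : DifferentialStructure M) (x : M → E) : Prop where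
  injective : Function.Injective x
  comp_mem : ∀ g : E → ℝ, ContDiff ℝ ∞ g → (fun q => g (x q)) ∈ F.carrier
  local_eq : ∀ f ∈ F.carrier, ∀ p, ∃ g : E → ℝ, ContDiff ℝ ∞ g ∧
    ∀ᶠ q in comap x (𝓝 (x p)), f q = g (x q)

theorem Diffeomorphic.exists_isSmoothEmbedding [FiniteDimensional ℝ E] {S : Set E}
    (h : Diffeomorphic F ((standard E).subspace S)) :
    ∃ x : M → E, IsSmoothEmbedding F x := by
  obtain ⟨e, he, he'⟩ := h
  refine ⟨fun q => e q, Subtype.val_injective.comp e.injective, fun g hg => ?_, fun f hf p => ?_⟩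
  · exact he _ (restrict_mem_subspace (F := standard E) hg S)
  · obtain ⟨g, hg, h⟩ := subspace_standard_subset S (he' f hf) (e p)
    refine ⟨g, hg, ?_⟩
    rw [nhds_subtype_eq_comap, eventually_comap] at h
    rw [eventually_comap]
    filter_upwards [h] with y hy q hq
    simpa using hy (e q) hq

namespace IsSmoothEmbedding

variable {x : M → E}

/-- A smooth function of the embedding, as an element of the algebra. -/
def pullback (hx : IsSmoothEmbedding F x) (g : E → ℝ) (hg : ContDiff ℝ ∞ g) : F.toSubalgebra :=
  ⟨fun q => g (x q), hx.comp_mem g hg⟩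

@[simp]
theorem pullback_apply (hx : IsSmoothEmbedding F x) (g : E → ℝ) (hg : ContDiff ℝ ∞ g) (q : M) :
    (hx.pullback g hg : M → ℝ) q = g (x q) := rfl

/-- Apply the Leibniz rule at `p` to `χ (a - b) = 0`, with `χ` a bump function equal to `1` at `x
p`. -/
theorem derivation_eq_of_eventuallyEq [FiniteDimensional ℝ E] (hx : IsSmoothEmbedding F x)
    (v : Derivation ℝ F.toSubalgebra F.toSubalgebra) {a b : F.toSubalgebra} {p : M}
    (h : ∀ᶠ q in comap x (𝓝 (x p)), (a : M → ℝ) q = (b : M → ℝ) q) :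
    (v a : M → ℝ) p = (v b : M → ℝ) p := by
  rw [eventually_comap] at h
  obtain ⟨r, hr, h⟩ := Metric.eventually_nhds_iff_ball.1 h
  let χ : ContDiffBump (x p) := ⟨r / 2, r, by positivity, by linarith⟩
  have h0 : hx.pullback χ χ.contDiff * (a - b) = 0 := by
    ext q
    change χ (x q) * ((a : M → ℝ) q - (b : M → ℝ) q) = 0
    by_cases hq : x q ∈ Metric.ball (x p) r
    · rw [h _ hq q rfl, sub_self, mul_zero]
    · rw [χ.zero_of_le_dist (by simpa using hq), zero_mul]
  have h1 := congrArg (fun f : F.toSubalgebra => (f : M → ℝ) p) (congrArg v h0)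
  rw [Derivation.leibniz, map_zero, map_sub] at h1
  have h2 : χ (x p) * ((v a : M → ℝ) p - (v b : M → ℝ) p) +
      ((a : M → ℝ) p - (b : M → ℝ) p) * (v (hx.pullback χ χ.contDiff) : M → ℝ) p = 0 := h1
  rw [h _ (Metric.mem_ball_self hr) p rfl, sub_self, zero_mul, add_zero,
    χ.one_of_mem_closedBall (Metric.mem_closedBall_self (by positivity)), one_mul] at h2
  linarith

end IsSmoothEmbedding

/-! ### Derivations as vector fields along the embedding -/

section Coordinates

variable {n : ℕ} {x : M → EuclideanSpace ℝ (Fin n)} (hx : IsSmoothEmbedding F x)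
  (v : Derivation ℝ F.toSubalgebra F.toSubalgebra)

namespace IsSmoothEmbedding

/-- The vector field along the embedding whose components are the values of the derivation on the
coordinate functions. -/
noncomputable def vectorField (q : M) : EuclideanSpace ℝ (Fin n) :=
  WithLp.toLp 2 fun i =>
    (v (hx.pullback (fun y => y i) (contDiff_piLp_apply 2)) : M → ℝ) q

/-- Hadamard's lemma writes `g ∘ x` as a constant plus a sum of products `(xᵢ - xᵢ(p)) Kᵢ`. At `p`
the Leibniz rule leaves only `v(xᵢ)(p) Kᵢ(p)`, and `Kᵢ(p)` is the partial derivative. -/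
theorem derivation_pullback (g : EuclideanSpace ℝ (Fin n) → ℝ) (hg : ContDiff ℝ ∞ g) (p : M) :
    (v (hx.pullback g hg) : M → ℝ) p = fderiv ℝ g (x p) (hx.vectorField v p) := by
  obtain ⟨k, hk, hk0, hgk⟩ := exists_contDiff_sub_eq_apply hg (x p)
  let b := EuclideanSpace.basisFun (Fin n) ℝ
  have hki : ∀ i, ContDiff ℝ ∞ fun y => k y (b i) := fun i => hk.clm_apply contDiff_const
  have hsum : ∀ y w : EuclideanSpace ℝ (Fin n), k y w = ∑ i, w i * k y (b i) := by
    intro y w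
    conv_lhs => rw [← b.sum_repr w]
    simp [b]
  let X : Fin n → F.toSubalgebra := fun i =>
    hx.pullback (fun y => y i) (contDiff_piLp_apply 2)
  let K : Fin n → F.toSubalgebra := fun i => hx.pullback _ (hki i)
  have hdec : hx.pullback g hg = algebraMap ℝ F.toSubalgebra (g (x p)) +
      ∑ i, (X i - algebraMap ℝ F.toSubalgebra (x p i)) * K i := by
    ext q
    change g (x q) = _
    rw [hgk (x q), hsum]
    simp [X, K, Algebra.algebraMap_eq_smul_one]
  rw [hdec, map_add, map_sum, Derivation.map_algebraMap, zero_add, ← hk0, hsum]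
  simp only [Derivation.leibniz, map_sub, Derivation.map_algebraMap, sub_zero]
  simp [X, K, vectorField, Algebra.algebraMap_eq_smul_one, mul_comm]

/-- The chain rule for derivations. -/
theorem derivation_apply {f : F.toSubalgebra} {g : EuclideanSpace ℝ (Fin n) → ℝ}
    (hg : ContDiff ℝ ∞ g) {p : M}
    (h : ∀ᶠ q in comap x (𝓝 (x p)), (f : M → ℝ) q = g (x q)) :
    (v f : M → ℝ) p = fderiv ℝ g (x p) (hx.vectorField v p) := by
  rw [← hx.derivation_pullback v g hg]
  exact hx.derivation_eq_of_eventuallyEq v h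

theorem exists_vectorField_eq (p : M) :
    ∃ X : EuclideanSpace ℝ (Fin n) → EuclideanSpace ℝ (Fin n), ContDiff ℝ ∞ X ∧
      ∀ᶠ q in comap x (𝓝 (x p)), hx.vectorField v q = X (x q) := by
  choose g hg h using fun i : Fin n => hx.local_eq _
    (v (hx.pullback (fun y => y i) (contDiff_piLp_apply 2))).2 p
  refine ⟨fun y => WithLp.toLp 2 fun i => g i y, contDiff_euclidean.2 hg, ?_⟩
  filter_upwards [eventually_all.2 h] with q hq
  simp only [vectorField]
  congr 1
  ext i
  exact hq i

end IsSmoothEmbedding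

end Coordinates

end Sikorski

/-! ### Flow of a locally smooth vector field along a map -/

namespace Sikorski

variable {M E : Type*} [NormedAddCommGroup E] [NormedSpace ℝ E]

/-- `γ`, restricted to the unit interval, is an integral curve of length `t` starting at `p` of the
vector field `b` along the map `x`, reparametrized proportionally. -/
structure IsScaledCurve (x b : M → E) (p : M) (t : ℝ) (γ : ℝ → M) : Prop where
  map_zero : γ 0 = p
  hasDeriv : ∀ s ∈ Icc (0 : ℝ) 1,
    HasDerivWithinAt (fun r => x (γ r)) (t • b (γ s)) (Icc 0 1) s

/-- A vector field along `x` is locally smooth if it is locally the restriction of a smooth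
vector field. -/
def LocallySmoothAlong (x b : M → E) : Prop :=
  ∀ p, ∃ X : E → E, ContDiff ℝ ∞ X ∧ ∀ᶠ q in comap x (𝓝 (x p)), b q = X (x q)

variable {x b : M → E} {p : M} {t : ℝ} {γ γ' : ℝ → M}

namespace IsScaledCurve

theorem continuousOn (h : IsScaledCurve x b p t γ) : ContinuousOn (fun r => x (γ r)) (Icc 0 1) :=
  fun s hs => (h.hasDeriv s hs).continuousWithinAt

theorem const (x b : M → E) (p : M) : IsScaledCurve x b p 0 fun _ => p :=
  ⟨rfl, fun s _ => by simpa using hasDerivWithinAt_const s (Icc 0 1) (x p)⟩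

theorem comp_affine (h : IsScaledCurve x b p t γ) {a k : ℝ}
    (hak : ∀ s ∈ Icc (0 : ℝ) 1, a + k * s ∈ Icc (0 : ℝ) 1) :
    IsScaledCurve x b (γ a) (k * t) fun s => γ (a + k * s) := by
  refine ⟨by simp, fun s hs => ?_⟩
  have h1 : HasDerivWithinAt (fun s : ℝ => a + k * s) k (Icc 0 1) s := by
    simpa using (((hasDerivAt_id s).const_mul k).const_add a).hasDerivWithinAt (s := Icc 0 1)
  have := (h.hasDeriv _ (hak s hs)).scomp s h1 hak
  rwa [smul_smul] at this

/-- Near a common point both images solve the same smooth equation in `E`, and injectivity of `x`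
brings the agreement back to `M`. -/
theorem unique (hx : Function.Injective x) (hb : LocallySmoothAlong x b)
    (h : IsScaledCurve x b p t γ) (h' : IsScaledCurve x b p t γ') : EqOn γ γ' (Icc 0 1) := by
  suffices H : EqOn (fun r => x (γ r)) (fun r => x (γ' r)) (Icc 0 1) from fun s hs => hx (H hs)
  refine eqOn_Icc_of_local_autonomous h.continuousOn h'.continuousOn
    (by simp [h.map_zero, h'.map_zero]) fun s hs hss => ?_
  obtain ⟨X, hX, hbX⟩ := hb (γ s)
  refine ⟨fun y => t • X y, contDiff_const.smul hX, ?_⟩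
  have key : ∀ {δ : ℝ → M}, IsScaledCurve x b p t δ → x (δ s) = x (γ s) →
      ∀ᶠ r in 𝓝[Icc 0 1] s, HasDerivWithinAt (fun r => x (δ r)) (t • X (x (δ r))) (Icc 0 1) r := by
    intro δ hδ hδs
    have h1 : Tendsto δ (𝓝[Icc 0 1] s) (comap x (𝓝 (x (γ s)))) :=
      tendsto_comap_iff.2 (hδs ▸ hδ.continuousOn s hs)
    filter_upwards [h1.eventually hbX, self_mem_nhdsWithin] with r hr hr1
    rw [← hr]
    exact hδ.hasDeriv r hr1
  exact (key h rfl).and (key h' hss.symm)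

/-- Only `w` is assumed to stay in `V`: wherever the curve meets `w` it lies in `V`, hence nearby
too by continuity, which suffices for uniqueness. -/
theorem eq_solution {X : E → E} (hX : ContDiff ℝ ∞ X) {V : Set E} (hV : IsOpen V)
    (hbX : ∀ q, x q ∈ V → b q = X (x q)) (h : IsScaledCurve x b p t γ) {w : ℝ → E}
    (hw0 : w 0 = x p) (hwV : ∀ s ∈ Icc (0 : ℝ) 1, w s ∈ V)
    (hw : ∀ s ∈ Icc (0 : ℝ) 1, HasDerivWithinAt w (t • X (w s)) (Icc 0 1) s) :
    EqOn (fun r => x (γ r)) w (Icc 0 1) := by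
  refine eqOn_Icc_of_local_autonomous h.continuousOn (fun s hs => (hw s hs).continuousWithinAt)
    (by simp [h.map_zero, hw0]) fun s hs hss => ?_
  refine ⟨fun y => t • X y, contDiff_const.smul hX, ?_⟩
  have h1 : ∀ᶠ r in 𝓝[Icc 0 1] s, x (γ r) ∈ V :=
    h.continuousOn s hs (hV.mem_nhds (by simpa only [hss] using hwV s hs))
  filter_upwards [h1, self_mem_nhdsWithin] with r hr hr1
  refine ⟨?_, hw r hr1⟩
  rw [← hbX _ hr]
  exact h.hasDeriv r hr1

end IsScaledCurve

/-- The domain of the flow of a vector field along a map. -/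
def flowDomain (x b : M → E) : Set (M × ℝ) := {z | ∃ γ, IsScaledCurve x b z.1 z.2 γ}

theorem zero_mem_flowDomain (x b : M → E) (p : M) : (p, (0 : ℝ)) ∈ flowDomain x b :=
  ⟨_, IsScaledCurve.const x b p⟩

open Classical in
/-- The flow of a vector field along a map, extended by the identity outside of its domain. -/
noncomputable def flowMap (x b : M → E) (z : M × ℝ) : M :=
  if h : z ∈ flowDomain x b then h.choose 1 else z.1

section Flow

variable (hx : Function.Injective x) (hb : LocallySmoothAlong x b)
include hx hb

theorem IsScaledCurve.flowMap_eq (h : IsScaledCurve x b p t γ) : flowMap x b (p, t) = γ 1 := by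
  have hz : (p, t) ∈ flowDomain x b := ⟨γ, h⟩
  rw [flowMap, dif_pos hz]
  exact hz.choose_spec.unique hx hb h (right_mem_Icc.2 zero_le_one)

theorem flowMap_zero (p : M) : flowMap x b (p, 0) = p :=
  (IsScaledCurve.const x b p).flowMap_eq hx hb

theorem IsScaledCurve.scale (h : IsScaledCurve x b p t γ) {c : ℝ} (hc : c ∈ Icc (0 : ℝ) 1) :
    (p, c * t) ∈ flowDomain x b ∧ flowMap x b (p, c * t) = γ c := by
  have h1 : IsScaledCurve x b p (c * t) fun s => γ (0 + c * s) := by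
    have := h.comp_affine (a := 0) (k := c) fun s hs => by
      rw [zero_add]; exact ⟨mul_nonneg hc.1 hs.1, mul_le_one₀ hc.2 hs.1 hs.2⟩
    rwa [h.map_zero] at this
  exact ⟨⟨_, h1⟩, by simpa using h1.flowMap_eq hx hb⟩

/-- For times of the same sign, one of the two curves contains the other. Restricting the longer one
to the segment between the two times, run forwards or backwards, gives the connecting curve. -/
theorem flowMap_flowMap_sub {t t₀ : ℝ} (h : (p, t) ∈ flowDomain x b)
    (h₀ : (p, t₀) ∈ flowDomain x b) (ht : t₀ = 0 ∨ 0 < t * t₀) :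
    (flowMap x b (p, t₀), t - t₀) ∈ flowDomain x b ∧
      flowMap x b (flowMap x b (p, t₀), t - t₀) = flowMap x b (p, t) := by
  rcases ht with rfl | ht
  · rw [flowMap_zero hx hb, sub_zero]
    exact ⟨h, rfl⟩
  have ht0 : t ≠ 0 := left_ne_zero_of_mul ht.ne'
  have ht0' : t₀ ≠ 0 := right_ne_zero_of_mul ht.ne'
  have hpos : 0 < t₀ / t := by
    rw [show t₀ / t = t * t₀ / (t * t) by field_simp]
    exact div_pos ht (mul_self_pos.2 ht0)
  obtain ⟨γ, hγ⟩ := h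
  obtain ⟨γ₀, hγ₀⟩ := h₀
  dsimp only at hγ hγ₀
  rcases le_total (t₀ / t) 1 with hle | hle
  · have e1 := (hγ.scale hx hb ⟨hpos.le, hle⟩).2
    rw [div_mul_cancel₀ _ ht0] at e1
    have h1 := hγ.comp_affine (a := t₀ / t) (k := 1 - t₀ / t) fun s hs =>
      ⟨add_nonneg hpos.le (mul_nonneg (sub_nonneg.2 hle) hs.1), by nlinarith [hs.2]⟩
    rw [← e1, sub_mul, one_mul, div_mul_cancel₀ _ ht0] at h1
    refine ⟨⟨_, h1⟩, ?_⟩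
    rw [h1.flowMap_eq hx hb, hγ.flowMap_eq hx hb]
    simp
  · have hle' : t / t₀ ≤ 1 := by
      rw [← inv_div]; exact inv_le_one_of_one_le₀ hle
    have hpos' : 0 ≤ t / t₀ := by
      rw [← inv_div]; exact inv_nonneg.2 hpos.le
    have e1 := (hγ₀.scale hx hb ⟨hpos', hle'⟩).2
    rw [div_mul_cancel₀ _ ht0'] at e1
    have h1 := hγ₀.comp_affine (a := 1) (k := t / t₀ - 1) fun s hs =>
      ⟨by nlinarith [hs.1, hs.2], by nlinarith [hs.1, hs.2]⟩
    rw [sub_mul, one_mul, div_mul_cancel₀ _ ht0', ← hγ₀.flowMap_eq hx hb] at h1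
    refine ⟨⟨_, h1⟩, ?_⟩
    rw [h1.flowMap_eq hx hb, e1]
    simp

theorem exists_contDiff_flowMap_eq_near_zero [FiniteDimensional ℝ E] (p₀ : M) :
    ∃ ψ : E × ℝ → E, ContDiff ℝ ∞ ψ ∧ HasDerivAt (fun t => ψ (x p₀, t)) (b p₀) 0 ∧
      ∀ᶠ z in comap (Prod.map x id) (𝓝 (x p₀, (0 : ℝ))),
        z ∈ flowDomain x b → x (flowMap x b z) = ψ (Prod.map x id z) := by
  have : CompleteSpace E := FiniteDimensional.complete ℝ E
  obtain ⟨X, hX, hbX⟩ := hb p₀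
  obtain ⟨Γ, hΓ0, hΓ⟩ := exists_smooth_localFlow hX (x p₀)
  have h0 := hΓ.self_of_nhds
  let ev : C(unitInterval, E) →L[ℝ] E := ContinuousMap.evalCLM ℝ (1 : unitInterval)
  obtain ⟨ψ, hψ, hψΓ⟩ := exists_contDiff_eventuallyEq (f := fun z => ev (Γ z))
    (y := (x p₀, (0 : ℝ))) (hΓ.mono fun z hz => ev.contDiff.contDiffAt.comp z hz.1)
  refine ⟨ψ, hψ, ?_, ?_⟩
  · let X' : C(E, E) := ⟨X, hX.continuous⟩
    let P : C(unitInterval, E) → E := fun γ => ev (ContinuousMap.primitive E (X'.comp γ))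
    have hP : ContDiff ℝ ∞ P :=
      ev.contDiff.comp ((ContinuousMap.primitive E).contDiff.comp
        (ContinuousMap.contDiff_comp_left X' hX))
    have hin : Tendsto (fun t : ℝ => (x p₀, t)) (𝓝 0) (𝓝 (x p₀, 0)) :=
      (Continuous.prodMk_right (x p₀)).tendsto 0
    have hd : DifferentiableAt ℝ (fun t : ℝ => P (Γ (x p₀, t))) 0 := by
      have h1 : ContDiffAt ℝ ∞ (fun t : ℝ => P (Γ (x p₀, t))) 0 :=
        hP.contDiffAt.comp (0 : ℝ) (h0.1.comp (0 : ℝ) (by fun_prop))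
      exact h1.differentiableAt (by simp)
    -- Near `0`, `ψ (x p₀, t) = x p₀ + t P(Γ (x p₀, t))`, so the derivative at `0` is `P(Γ (x p₀,
    -- 0)) = X (x p₀)`.
    have h2 := ((hasDerivAt_id (0 : ℝ)).smul hd.hasDerivAt).const_add (x p₀)
    have h3 : P (Γ (x p₀, 0)) = b p₀ := by
      have e1 : X'.comp (ContinuousMap.const unitInterval (x p₀)) =
        ContinuousMap.const _ (X (x p₀)) := rfl
      have e2 : b p₀ = X (x p₀) := by
        rw [eventually_comap] at hbX
        exact hbX.self_of_nhds p₀ rfl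
      simp only [P, hΓ0, e1, e2]
      simp [ev, ContinuousMap.primitive_apply, IccExtend]
    simp only [h3, id_eq, zero_smul, one_smul, zero_add] at h2
    refine h2.congr_of_eventuallyEq ?_
    filter_upwards [hin.eventually hψΓ, hin.eventually hΓ] with t h4 h5
    change _ = x p₀ + t • P (Γ (x p₀, t))
    rw [h4, congrArg ev h5.2, map_add, map_smul]
    rfl
  · rw [eventually_comap] at hbX
    obtain ⟨r, hr, hr'⟩ := Metric.eventually_nhds_iff_ball.1 hbX
    -- Sup-norm closeness to the constant curve keeps the whole solution in the ball where `b` is `X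
    -- ∘ x`, so `eq_solution` applies.
    have hnear : ∀ᶠ z in 𝓝 (x p₀, (0 : ℝ)), dist (Γ z) (Γ (x p₀, 0)) < r :=
      h0.1.continuousAt.eventually (Metric.ball_mem_nhds _ hr)
    refine eventually_comap.2 ?_
    filter_upwards [hnear, hΓ, hψΓ] with z hz1 hz2 hz3
    rintro ⟨q, t⟩ rfl ⟨γ, hγ⟩
    rw [hγ.flowMap_eq hx hb, hz3]
    have := hγ.eq_solution hX (V := Metric.ball (x p₀) r) Metric.isOpen_ball
      (fun q hq => hr' _ hq q rfl) (w := IccExtend zero_le_one (Γ (x q, t))) ?_ ?_ ?_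
      (right_mem_Icc.2 zero_le_one)
    · simpa [ev, IccExtend] using this
    · rw [IccExtend_of_mem _ _ (left_mem_Icc.2 zero_le_one)]
      have e := congrArg (fun γ : C(unitInterval, E) => γ 0) hz2.2
      simpa [ContinuousMap.primitive_apply] using e
    · intro s hs
      rw [IccExtend_of_mem _ _ hs]
      have := (ContinuousMap.dist_apply_le_dist (f := Γ (x q, t)) (g := Γ (x p₀, 0))
        ⟨s, hs⟩).trans_lt hz1
      rwa [hΓ0] at this
    · intro s hs
      rw [IccExtend_of_mem _ _ hs]
      exact hasDerivWithinAt_of_eq_const_add_primitive hz2.2 hs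

/-- The group law moves the question to time zero at the point reached; for `t₀ ≠ 0`, times near
`t₀` have its sign. -/
theorem hasDerivWithinAt_flowMap [FiniteDimensional ℝ E] {p : M} {t₀ : ℝ}
    (h : (p, t₀) ∈ flowDomain x b) :
    HasDerivWithinAt (fun t => x (flowMap x b (p, t))) (b (flowMap x b (p, t₀)))
      {t | (p, t) ∈ flowDomain x b} t₀ := by
  obtain ⟨ψ, -, hψ', hψ⟩ := exists_contDiff_flowMap_eq_near_zero hx hb (flowMap x b (p, t₀))
  have h1 : HasDerivAt (fun t => ψ (x (flowMap x b (p, t₀)), t - t₀)) (b (flowMap x b (p, t₀)))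
      t₀ := by
    rw [← sub_self t₀] at hψ'
    exact hψ'.comp_sub_const t₀ t₀
  have h2 : ∀ᶠ t in 𝓝 t₀, t₀ = 0 ∨ 0 < t * t₀ := by
    rcases eq_or_ne t₀ 0 with h0 | h0
    · exact Eventually.of_forall fun _ => Or.inl h0
    · have : ContinuousAt (fun t => t * t₀) t₀ := by fun_prop
      exact (this.eventually (lt_mem_nhds (mul_self_pos.2 h0))).mono fun _ => Or.inr
  have h3 : Tendsto (fun t => (flowMap x b (p, t₀), t - t₀)) (𝓝 t₀)
      (comap (Prod.map x id) (𝓝 (x (flowMap x b (p, t₀)), (0 : ℝ)))) := by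
    rw [tendsto_comap_iff]
    have : ContinuousAt (fun t => (x (flowMap x b (p, t₀)), t - t₀)) t₀ := by fun_prop
    rw [ContinuousAt, sub_self] at this
    exact this
  refine h1.hasDerivWithinAt.congr_of_eventuallyEq_of_mem ?_ h
  filter_upwards [h2.filter_mono nhdsWithin_le_nhds,
    (h3.eventually hψ).filter_mono nhdsWithin_le_nhds, self_mem_nhdsWithin] with t h4 h5 h6
  have h7 := flowMap_flowMap_sub hx hb h6 h h4
  rw [← h7.2]
  exact h5 h7.1

/-- Local representability is carried along the curve from `p₀` in finitely many short steps, each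
composing the representative found so far with a short-time one. -/
theorem exists_contDiff_flowMap_eq [FiniteDimensional ℝ E] {z₀ : M × ℝ}
    (hz₀ : z₀ ∈ flowDomain x b) :
    ∃ G : E × ℝ → E, ContDiff ℝ ∞ G ∧
      ∀ᶠ z in comap (Prod.map x id) (𝓝 (Prod.map x id z₀)),
        z ∈ flowDomain x b → x (flowMap x b z) = G (Prod.map x id z) := by
  obtain ⟨p₀, t₀⟩ := z₀
  obtain ⟨γ, hγ⟩ := hz₀
  dsimp only at hγ
  let T : unitInterval → Prop := fun θ => ∃ G : E × ℝ → E, ContDiff ℝ ∞ G ∧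
      ∀ᶠ z in comap (Prod.map x id) (𝓝 (x p₀, (θ : ℝ) * t₀)),
        z ∈ flowDomain x b → x (flowMap x b z) = G (Prod.map x id z)
  suffices hT : T 1 by simpa [T] using hT
  have hloc : ∀ θ₀ : unitInterval, ∃ c : Set unitInterval, IsOpen c ∧ θ₀ ∈ c ∧
      ∀ θ ∈ c, ∀ θ' ∈ c, θ ≤ θ' → T θ → T θ' := by
    intro θ₀
    obtain ⟨ψ, hψ, -, hψe⟩ := exists_contDiff_flowMap_eq_near_zero hx hb (γ θ₀)
    rw [eventually_comap] at hψe
    have hcont : Continuous fun θ : unitInterval => x (γ θ) :=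
      continuousOn_iff_continuous_domRestrict.1 hγ.continuousOn
    have hcont' : Continuous fun θ : unitInterval × unitInterval =>
        (x (γ θ.1), ((θ.2 : ℝ) - θ.1) * t₀) :=
      (hcont.comp continuous_fst).prodMk (by fun_prop)
    -- This selects `c` so that one `ψ`, centred at `γ θ₀`, handles every step between two
    -- parameters in `c`.
    have hev := hcont'.continuousAt (x := (θ₀, θ₀)) |>.eventually
      (p := fun z => ∀ᶠ z in 𝓝 z, ∀ a, Prod.map x id a = z →
        a ∈ flowDomain x b → x (flowMap x b a) = ψ (Prod.map x id a))
      (by simpa using hψe.eventually_nhds)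
    obtain ⟨c, hc, hθc, hcc⟩ := exists_nhds_square hev
    refine ⟨c, hc, hθc, ?_⟩
    rintro θ hθ θ' hθ' hle ⟨G, hG, hGe⟩
    rcases hle.eq_or_lt with rfl | hlt
    · exact ⟨G, hG, hGe⟩
    have hpos : 0 < (θ' : ℝ) := θ.2.1.trans_lt hlt
    set k : ℝ := θ / θ' with hk
    have hkI : k ∈ Icc (0 : ℝ) 1 :=
      ⟨div_nonneg θ.2.1 hpos.le, div_le_one_of_le₀ (by exact_mod_cast hle) hpos.le⟩
    have hkθ : k * (θ' * t₀) = θ * t₀ := by rw [← mul_assoc, hk, div_mul_cancel₀ _ hpos.ne']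
    have hscale := hγ.scale hx hb θ.2
    rw [eventually_comap] at hGe
    have hGγ : G (x p₀, θ * t₀) = x (γ θ) := by
      rw [← hscale.2]
      exact (hGe.self_of_nhds _ rfl hscale.1).symm
    -- Flow for the fraction `k = θ / θ'` of the time by `G`, then for the rest by `ψ`.
    refine ⟨fun z => ψ (G (z.1, k * z.2), (1 - k) * z.2), ?_, ?_⟩
    · exact hψ.comp ((hG.comp (contDiff_fst.prodMk (contDiff_const.mul contDiff_snd))).prodMk
        (contDiff_const.mul contDiff_snd))
    have t1 : Tendsto (fun z : E × ℝ => (z.1, k * z.2)) (𝓝 (x p₀, θ' * t₀))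
        (𝓝 (x p₀, θ * t₀)) := by
      have : ContinuousAt (fun z : E × ℝ => (z.1, k * z.2)) (x p₀, θ' * t₀) := by fun_prop
      rwa [ContinuousAt, hkθ] at this
    have t2 : Tendsto (fun z : E × ℝ => (G (z.1, k * z.2), (1 - k) * z.2))
        (𝓝 (x p₀, θ' * t₀)) (𝓝 (x (γ θ), (θ' - θ) * t₀)) := by
      refine Tendsto.prodMk_nhds ?_ ?_
      · rw [← hGγ]
        exact (hG.continuous.tendsto _).comp t1
      · have : ContinuousAt (fun z : E × ℝ => (1 - k) * z.2) (x p₀, θ' * t₀) := by fun_prop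
        rw [ContinuousAt, sub_mul, one_mul, hkθ, ← sub_mul] at this
        exact this
    rw [eventually_comap]
    have hev2 := (hcc (mk_mem_prod hθ hθ') : ∀ᶠ z in 𝓝 (x (γ θ), ((θ' : ℝ) - θ) * t₀), _)
    filter_upwards [t1.eventually hGe, t2.eventually hev2] with z hz1 hz2
    rintro ⟨p, t⟩ rfl hpt
    obtain ⟨δ, hδ⟩ := id hpt
    have h1 := (hδ.scale hx hb hkI).1
    have h2 := hz1 (p, k * t) rfl h1
    have h3 : k * t = 0 ∨ 0 < t * (k * t) := by
      rcases hkI.1.eq_or_lt with h | h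
      · exact Or.inl (by rw [← h, zero_mul])
      rcases eq_or_ne t 0 with h' | h'
      · exact Or.inl (by rw [h', mul_zero])
      · refine Or.inr ?_
        rw [mul_left_comm]
        exact mul_pos h (mul_self_pos.2 h')
    have h4 := flowMap_flowMap_sub hx hb hpt h1 h3
    rw [show t - k * t = (1 - k) * t by ring] at h4
    rw [← h4.2]
    have h5 : Prod.map x id (flowMap x b (p, k * t), (1 - k) * t) =
        (G (x p, k * t), (1 - k) * t) := Prod.ext h2 rfl
    rw [hz2 _ h5 h4.1, h5]
    rfl
  have h0 : T 0 := by
    obtain ⟨ψ, hψ, -, hψe⟩ := exists_contDiff_flowMap_eq_near_zero hx hb p₀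
    exact ⟨ψ, hψ, by simpa using hψe⟩
  choose c hc hmem hstep using hloc
  obtain ⟨τ, hτ0, hτ, ⟨m, hm⟩, hsub⟩ :=
    exists_monotone_Icc_subset_open_cover_unitInterval hc fun θ _ => mem_iUnion.2 ⟨θ, hmem θ⟩
  have hall : ∀ k, T (τ k) := by
    intro k
    induction k with
    | zero => rwa [hτ0]
    | succ k ih =>
      obtain ⟨i, hi⟩ := hsub k
      have hle := hτ k.le_succ
      exact hstep i _ (hi (left_mem_Icc.2 hle)) _ (hi (right_mem_Icc.2 hle)) hle ih
  rw [← hm m le_rfl]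
  exact hall m

end Flow

end Sikorski

/-! ### From the vector field back to the derivation -/

namespace Sikorski

open DifferentialStructure

variable {M : Type*} {F : DifferentialStructure M}

section FlowDomain

variable {E : Type*} [NormedAddCommGroup E] [NormedSpace ℝ E] {x b : M → E}

theorem isConnected_flowDomain (hx : Function.Injective x) (hb : LocallySmoothAlong x b) (p : M) :
    IsConnected {t : ℝ | (p, t) ∈ flowDomain x b} := by
  have hstar : StarConvex ℝ 0 {t : ℝ | (p, t) ∈ flowDomain x b} := by
    rw [starConvex_zero_iff]
    rintro t ⟨γ, hγ⟩ c hc0 hc1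
    exact (hγ.scale hx hb ⟨hc0, hc1⟩).1
  exact (hstar.isPathConnected (zero_mem_flowDomain x b p)).isConnected

theorem IsSmoothEmbedding.exists_contDiff_comp_flowMap_eq [FiniteDimensional ℝ E]
    (hx : IsSmoothEmbedding F x) (hb : LocallySmoothAlong x b) {f : M → ℝ} (hf : f ∈ F.carrier)
    {z₀ : M × ℝ} (hz₀ : z₀ ∈ flowDomain x b) :
    ∃ g : E × ℝ → ℝ, ContDiff ℝ ∞ g ∧
      ∀ᶠ z in comap (Prod.map x id) (𝓝 (Prod.map x id z₀)),
        z ∈ flowDomain x b → f (flowMap x b z) = g (Prod.map x id z) := by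
  obtain ⟨G, hG, hGe⟩ := exists_contDiff_flowMap_eq hx.injective hb hz₀
  obtain ⟨g, hg, hge⟩ := hx.local_eq f hf (flowMap x b z₀)
  rw [eventually_comap] at hGe hge
  refine ⟨g ∘ G, hg.comp hG, eventually_comap.2 ?_⟩
  have h0 := hGe.self_of_nhds z₀ rfl hz₀
  rw [h0] at hge
  filter_upwards [hGe, hG.continuous.continuousAt.eventually hge] with z hz1 hz2 a ha haW
  have h1 := hz1 a ha haW
  subst ha
  rw [hz2 _ h1, h1]
  rfl

theorem IsSmoothEmbedding.isSmooth_flowMap [FiniteDimensional ℝ E]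
    (hx : IsSmoothEmbedding F x) (hb : LocallySmoothAlong x b) :
    IsSmooth ((F.prod (standard ℝ)).subspace (flowDomain x b)) F
      (fun w => flowMap x b w) := by
  intro f hf
  refine mem_of_local_comp _ (c := fun w : flowDomain x b => Prod.map x id (w : M × ℝ))
    (fun l => ?_) fun w => ?_
  -- A functional on `E × ℝ` splits as `l (y, t) = l (y, 0) + l (0, t)`, a sum of functions pulled
  -- back from the factors.
  · have h1 : (fun z : M × ℝ => l (x z.1, 0)) ∈ (F.prod (standard ℝ)).carrier :=
      subset_generate _ (Or.inl ⟨_, hx.comp_mem (fun y => l (y, 0))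
        (l.contDiff.comp (by fun_prop)), rfl⟩)
    have h2 : (fun z : M × ℝ => l (0, z.2)) ∈ (F.prod (standard ℝ)).carrier :=
      subset_generate _ (Or.inr ⟨fun t => l (0, t),
        (l.contDiff.comp (by fun_prop) : ContDiff ℝ ∞ fun t : ℝ => l ((0 : E), t)), rfl⟩)
    have h3 := restrict_mem_subspace ((F.prod (standard ℝ)).toSubalgebra.add_mem h1 h2)
      (flowDomain x b)
    convert h3 using 2 with w
    simp [← map_add]
    rfl
  · obtain ⟨g, hg, hge⟩ := hx.exists_contDiff_comp_flowMap_eq hb hf w.2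
    refine ⟨g, hg, ?_⟩
    rw [eventually_comap] at hge ⊢
    filter_upwards [hge] with z hz w hw using hz w hw w.2

theorem IsSmoothEmbedding.isSmooth_flowMap_curve [FiniteDimensional ℝ E]
    (hx : IsSmoothEmbedding F x) (hb : LocallySmoothAlong x b) (p : M) :
    IsSmooth ((standard ℝ).subspace {t : ℝ | (p, t) ∈ flowDomain x b}) F
      (fun t => flowMap x b (p, t)) := by
  intro f hf
  refine mem_of_local_comp _ (c := fun t : {t : ℝ | (p, t) ∈ flowDomain x b} => (t : ℝ))
    (fun l => ?_) fun t => ?_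
  · have hl : ContDiff ℝ ∞ l := l.contDiff
    exact restrict_mem_subspace (F := standard ℝ) (f := l) hl _
  · obtain ⟨g, hg, hge⟩ := hx.exists_contDiff_comp_flowMap_eq hb hf t.2
    refine ⟨fun s => g (x p, s), hg.comp (by fun_prop), ?_⟩
    rw [eventually_comap] at hge ⊢
    have hc : Tendsto (fun s : ℝ => (x p, s)) (𝓝 t) (𝓝 (x p, (t : ℝ))) :=
      (Continuous.prodMk_right (x p)).tendsto _
    filter_upwards [hc.eventually hge] with s hs r hr
    subst hr
    exact hs (p, r) rfl r.2

end FlowDomain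

theorem extend_val_apply {J : Set ℝ} {α : Type*} (g : J → α) (e : ℝ → α) {s : ℝ} (hs : s ∈ J) :
    Function.extend Subtype.val g e s = g ⟨s, hs⟩ :=
  Subtype.val_injective.extend_apply g e ⟨s, hs⟩

section Coordinates

variable {n : ℕ} {x : M → EuclideanSpace ℝ (Fin n)} (hx : IsSmoothEmbedding F x)
  (v : Derivation ℝ F.toSubalgebra F.toSubalgebra)

theorem IsSmoothEmbedding.locallySmoothAlong : LocallySmoothAlong x (hx.vectorField v) :=
  hx.exists_vectorField_eq v

/-- Integral curves of a derivation provide points of the domain of the flow of its vector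
field. -/
theorem IsIntegralCurve.mem_flowDomain {v : Derivation ℝ F.toSubalgebra F.toSubalgebra}
    {K : Set ℝ} {τ : K → M} (hτ : IsIntegralCurve v K τ) (t : K) :
    (τ ⟨0, hτ.zero_mem⟩, (t : ℝ)) ∈ flowDomain x (hx.vectorField v) ∧
      flowMap x (hx.vectorField v) (τ ⟨0, hτ.zero_mem⟩, t) = τ t := by
  rcases hτ.deriv_eq with hK | ⟨-, hd⟩
  · obtain rfl : t = ⟨0, hτ.zero_mem⟩ := Subtype.ext (hK t.2 hτ.zero_mem)
    exact ⟨zero_mem_flowDomain _ _ _, flowMap_zero hx.injective (hx.locallySmoothAlong v) _⟩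
  -- The value off `K` is arbitrary; `τ t` is merely an available point of `M`.
  let τ' : ℝ → M := Function.extend Subtype.val τ fun _ => τ t
  have hτ' : ∀ s (hs : s ∈ K), τ' s = τ ⟨s, hs⟩ := fun s hs => extend_val_apply _ _ hs
  have hder : ∀ s ∈ K, HasDerivWithinAt (fun s => x (τ' s)) (hx.vectorField v (τ' s)) K s := by
    intro s hs
    rw [hasDerivWithinAt_iff_hasFDerivWithinAt, hasFDerivWithinAt_euclidean]
    intro i
    suffices h : HasDerivWithinAt (fun s => x (τ' s) i) (hx.vectorField v (τ' s) i) K s by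
      refine h.hasFDerivWithinAt.congr_fderiv ?_
      ext
      simp
    have h1 := hd (hx.pullback (fun y => y i) (contDiff_piLp_apply 2)) ⟨s, hs⟩
    rw [hτ' s hs]
    refine HasDerivWithinAt.congr_of_mem h1 (fun r hr => ?_) hs
    rw [extend_val_apply _ _ hr, hτ' r hr]
    rfl
  have hmaps : ∀ s ∈ Icc (0 : ℝ) 1, (t : ℝ) * s ∈ K := by
    intro s hs
    have := hτ.connected.isPreconnected.ordConnected.uIcc_subset hτ.zero_mem t.2
    refine this ?_
    rw [← segment_eq_uIcc]
    exact ⟨1 - s, s, sub_nonneg.2 hs.2, hs.1, by ring, by simp [mul_comm]⟩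
  have hscaled : IsScaledCurve x (hx.vectorField v) (τ ⟨0, hτ.zero_mem⟩) t
      fun s => τ' (t * s) := by
    refine ⟨by rw [mul_zero, hτ'], fun s hs => ?_⟩
    have h1 : HasDerivWithinAt (fun s : ℝ => (t : ℝ) * s) t (Icc 0 1) s := by
      simpa using ((hasDerivAt_id s).const_mul (t : ℝ)).hasDerivWithinAt (s := Icc 0 1)
    exact (hder _ (hmaps s hs)).scomp s h1 hmaps
  refine ⟨⟨_, hscaled⟩, ?_⟩
  rw [hscaled.flowMap_eq hx.injective (hx.locallySmoothAlong v), mul_one, hτ' _ t.2]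

theorem IsSmoothEmbedding.isMaximalIntegralCurve_flowMap (p : M) :
    IsMaximalIntegralCurve v {t : ℝ | (p, t) ∈ flowDomain x (hx.vectorField v)}
      (fun t => flowMap x (hx.vectorField v) (p, t)) where
  zero_mem := zero_mem_flowDomain _ _ _
  connected := isConnected_flowDomain hx.injective (hx.locallySmoothAlong v) p
  deriv_eq := by
    -- The differential alternative holds even when the domain is `{0}`, where the derivative
    -- condition is vacuous.
    refine Or.inr ⟨hx.isSmooth_flowMap_curve (hx.locallySmoothAlong v) p, fun f t => ?_⟩
    obtain ⟨g, hg, hge⟩ := hx.local_eq f f.2 (flowMap x (hx.vectorField v) (p, t))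
    have hd := hasDerivWithinAt_flowMap hx.injective (hx.locallySmoothAlong v) t.2
    have h1 := (hg.differentiable (by simp) _).hasFDerivAt.comp_hasDerivWithinAt (t : ℝ) hd
    rw [← hx.derivation_apply v hg hge] at h1
    refine HasDerivWithinAt.congr_of_eventuallyEq_of_mem h1 ?_ t.2
    have h2 : Tendsto (fun s : ℝ => flowMap x (hx.vectorField v) (p, s))
        (𝓝[{t : ℝ | (p, t) ∈ flowDomain x (hx.vectorField v)}] t)
        (comap x (𝓝 (x (flowMap x (hx.vectorField v) (p, t))))) :=
      tendsto_comap_iff.2 hd.continuousWithinAt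
    filter_upwards [h2.eventually hge, self_mem_nhdsWithin] with s h3 h4
    exact (extend_val_apply _ _
      (show s ∈ {t : ℝ | (p, t) ∈ flowDomain x (hx.vectorField v)} from h4)).trans h3
  maximal := by
    intro K τ hτ h0
    rw [flowMap_zero hx.injective (hx.locallySmoothAlong v)] at h0
    have h := hτ.mem_flowDomain hx
    rw [h0] at h
    exact ⟨fun t ht => (h ⟨t, ht⟩).1, fun t => (h t).2⟩

theorem IsSmoothEmbedding.isFlow_flowMap :
    IsFlow v (flowDomain x (hx.vectorField v)) (fun w => flowMap x (hx.vectorField v) w) where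
  smooth := hx.isSmooth_flowMap (hx.locallySmoothAlong v)
  zero_mem := zero_mem_flowDomain _ _
  map_zero := flowMap_zero hx.injective (hx.locallySmoothAlong v)
  connected := isConnected_flowDomain hx.injective (hx.locallySmoothAlong v)
  maximal := hx.isMaximalIntegralCurve_flowMap v

end Coordinates

/-! ### Uniqueness from maximality -/

section Uniqueness

variable {v : Derivation ℝ F.toSubalgebra F.toSubalgebra} {W W' : Set (M × ℝ)} {Φ : W → M}
  {Φ' : W' → M}

theorem IsFlow.exists_restrict (h : IsFlow v W Φ) (h' : IsFlow v W' Φ') :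
    ∃ hW : W' ⊆ W, ∀ w : W', Φ ⟨w, hW w.2⟩ = Φ' w := by
  have key := fun p => (h.maximal p).maximal _ _ (h'.maximal p).toIsIntegralCurve
    ((h'.map_zero p).trans (h.map_zero p).symm)
  exact ⟨fun w hw => (key w.1).1 hw, fun w => (key w.1.1).2 ⟨w.1.2, w.2⟩⟩

theorem IsFlow.unique (h : IsFlow v W Φ) (h' : IsFlow v W' Φ') :
    (⟨W, Φ⟩ : Σ W : Set (M × ℝ), (W → M)) = ⟨W', Φ'⟩ := by
  obtain ⟨h1, h2⟩ := h.exists_restrict h'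
  obtain ⟨h3, -⟩ := h'.exists_restrict h
  obtain rfl := h1.antisymm h3
  exact congrArg (Sigma.mk W') (funext fun w => h2 w)

end Uniqueness

end Sikorski

theorem theorem3p12 {M : Type*} (F : Sikorski.DifferentialStructure M)
    (hM : ∃ (n : ℕ) (S : Set (EuclideanSpace ℝ (Fin n))),
      Sikorski.Diffeomorphic F
        ((Sikorski.DifferentialStructure.standard (EuclideanSpace ℝ (Fin n))).subspace S))
    (v : Derivation ℝ F.toSubalgebra F.toSubalgebra) :
    ∃! p : (Σ W : Set (M × ℝ), (W → M)), Sikorski.IsFlow v p.1 p.2 := by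
  obtain ⟨n, S, hS⟩ := hM
  obtain ⟨x, hx⟩ := hS.exists_isSmoothEmbedding
  exact ⟨_, hx.isFlow_flowMap v, fun p hp => hp.unique (hx.isFlow_flowMap v)⟩
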